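/- Let $(\Omega,\mu)$ be a probability space, let $\mathcal L$ be a set of functions $\phi:\mathbb R\to\mathbb R$ that are convex, bounded below, and differentiable at $0$ with $\phi'(0)<0$ (bounded-below convex calibrated losses), and let $\Phi:\Omega\to\mathcal L$ be a random loss (so that $\Phi(z)$ is a random variable for every $z\in\mathbb R$) such that: 1. $\mathbb E\,\Phi(z)$ exists and is finite for every $z\in\mathbb R$; 2. there is an integrable random variable $U$ with $\Phi(z)\ge U$ a.s. for every $z\in\mathbb R$; 3. there are an integrable random variable $G$ and a $\delta_0>0$ such that, for every $\delta\in[-\delta_0,\delta_0]$, a.s. every subgradient $g\in\partial\Phi(\delta)$ satisfies $|g|\le G$. Fix the value $\operatorname{sign}(0)\in\{-1,+1\}$ arbitrarily. Let $(X,Y)$ be a random pair with values in $\mathcal X\times\{-1,+1\}$, where $\mathcal X$ is a measurable space (for instance a subset of $\mathbb R^d$), independent of $\Phi$ and with arbitrary distribution. For measurable $f:\mathcal X\to\mathbb R$ put $$R(f)=\mathbb P\big(\operatorname{sign}(f(X))\ne Y\big),\qquad \overline R(f)=\mathbb E_{X,Y}\,\mathbb E_\Phi\,\Phi\big(Yf(X)\big)\in(-\infty,+\infty],$$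 and let all infima over $f$ be over measurable functions $\mathcal X\to\mathbb R$. Then $\overline R$ is classification-calibrated: for every distribution of $(X,Y)$ and every sequence of measurable functions $f_n$, $$\overline R(f_n)\to\inf_f\overline R(f)\quad\text{implies}\quad R(f_n)\to\inf_f R(f).$$ Moreover, the function $$\psi(\theta)=\mathbb E\,\Phi(0)-\inf_{\alpha\in\mathbb R}\mathbb E\Big(\tfrac{1+\theta}{2}\Phi(\alpha)+\tfrac{1-\theta}{2}\Phi(-\alpha)\Big)$$ is a strictly increasing bijection from $[0,1]$ onto $[0,\psi(1)]$ with $\psi(0)=0$, the infimum $\inf_f\overline R(f)$ is finite, and for every distribution of $(X,Y)$ and every measurable $f$, $$R(f)-\inf_f R(f)\le\psi^{-1}\Big(\overline R(f)-\inf_f\overline R(f)\Big),$$ where $\psi^{-1}:[0,\psi(1)]\to[0,1]$ is the inverse function of $\psi$, extended by $\psi^{-1}(t)=1$ for $t\in(\psi(1),+\infty]$. -/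

import Mathlib

open MeasureTheory Set Filter
open scoped Topology ENNReal

/-- The label set `{+1, -1}`, with the measurable structure inherited from `ℝ`. -/
abbrev Label : Type := {y : ℝ // y = 1 ∨ y = -1}

/-- The class predicted from the score `t`: the sign of `t`, with the value `s₀` at `t = 0`. -/
noncomputable def predict (s₀ : Label) (t : ℝ) : Label :=
  if 0 < t then ⟨1, Or.inl rfl⟩ else if t < 0 then ⟨-1, Or.inr rfl⟩ else s₀

/-- The extended expectation `E[g⁺] - E[g⁻]` of a real function `g`. It is the usual expectation,
with value in `(-∞, +∞]`, as soon as `E[g⁻] < ∞`, in particular when `g` is bounded below. -/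
noncomputable def extExpectation {α : Type*} [MeasurableSpace α] (P : Measure α) (g : α → ℝ) :
    EReal :=
  ((∫⁻ a, ENNReal.ofReal (g a) ∂P : ℝ≥0∞) : EReal)
    - ((∫⁻ a, ENNReal.ofReal (-g a) ∂P : ℝ≥0∞) : EReal)

/-- Bounded below, convex, calibrated losses: `φ` is convex on `ℝ`, `inf φ > -∞`, and `φ` is
differentiable at `0` with `φ'(0) < 0`. -/
structure IsBCCLoss (φ : ℝ → ℝ) : Prop where
  convex : ConvexOn ℝ univ φ
  bddBelow : BddBelow (range φ)
  differentiableAt_zero : DifferentiableAt ℝ φ 0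
  deriv_zero_neg : deriv φ 0 < 0

/-- `g` belongs to the subdifferential `∂φ(z)`. -/
def IsSubgradientAt (φ : ℝ → ℝ) (z g : ℝ) : Prop :=
  ∀ w : ℝ, φ z + g * (w - z) ≤ φ w

section RandomLoss

variable {Ω : Type*} [MeasurableSpace Ω] {𝓛 : Set (ℝ → ℝ)}

/-- The regularity assumption on the random loss `Φ`, defined on the probability space `(Ω, μ)`:
finite expectations, an integrable lower bound, and an integrable bound on the subgradients
near `0`. -/
structure RandomLossAssumption (μ : Measure Ω) (Φ : Ω → 𝓛) : Prop where
  integrable_eval : ∀ z : ℝ, Integrable (fun ω => (Φ ω : ℝ → ℝ) z) μ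
  exists_lower_bound : ∃ U : Ω → ℝ, Integrable U μ ∧
    ∀ z : ℝ, ∀ᵐ ω ∂μ, U ω ≤ (Φ ω : ℝ → ℝ) z
  exists_subgradient_bound : ∃ (G : Ω → ℝ) (δ₀ : ℝ), Integrable G μ ∧ 0 < δ₀ ∧
    ∀ δ ∈ Icc (-δ₀) δ₀, ∀ᵐ ω ∂μ, ∀ g : ℝ, IsSubgradientAt (Φ ω : ℝ → ℝ) δ g → |g| ≤ G ω

/-- The function
`ψ(θ) = E Φ(0) - inf_α E[(1+θ)/2 * Φ(α) + (1-θ)/2 * Φ(-α)]`, used for `θ ∈ [0, 1]`. -/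
noncomputable def psi (μ : Measure Ω) (Φ : Ω → 𝓛) (θ : ℝ) : ℝ :=
  (∫ ω, (Φ ω : ℝ → ℝ) 0 ∂μ)
    - ⨅ α : ℝ, ∫ ω, ((1 + θ) / 2 * (Φ ω : ℝ → ℝ) α + (1 - θ) / 2 * (Φ ω : ℝ → ℝ) (-α)) ∂μ

/-- The inverse of `ψ : [0, 1] → [0, ψ(1)]`, extended by the value `1` to arguments
above `ψ(1)`: `ψ⁻¹(t) = sup {θ ∈ [0, 1] : ψ(θ) ≤ t}`. -/
noncomputable def psiInv (μ : Measure Ω) (Φ : Ω → 𝓛) (t : EReal) : ℝ :=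
  sSup {θ : ℝ | θ ∈ Icc (0 : ℝ) 1 ∧ (psi μ Φ θ : EReal) ≤ t}

variable {𝒳 : Type*} [MeasurableSpace 𝒳]

/-- The misclassification risk `R(f) = P(sign f(X) ≠ Y)` under the law `P` of `(X, Y)`. -/
noncomputable def risk (s₀ : Label) (P : Measure (𝒳 × Label)) (f : 𝒳 → ℝ) : ℝ :=
  P.real {p | predict s₀ (f p.1) ≠ p.2}

/-- `inf_f R(f)` over all measurable `f`. -/
noncomputable def riskInf (s₀ : Label) (P : Measure (𝒳 × Label)) : ℝ :=
  ⨅ f : {f : 𝒳 → ℝ // Measurable f}, risk s₀ P f.1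

/-- The ensemble risk `E_{X,Y} (E_Φ Φ(Y f(X)))`, which may be `+∞`. -/
noncomputable def ensembleRisk (μ : Measure Ω) (Φ : Ω → 𝓛) (P : Measure (𝒳 × Label))
    (f : 𝒳 → ℝ) : EReal :=
  extExpectation P (fun p => ∫ ω, (Φ ω : ℝ → ℝ) ((p.2 : ℝ) * f p.1) ∂μ)

/-- The infimum of the ensemble risk over all measurable `f`. -/
noncomputable def ensembleRiskInf (μ : Measure Ω) (Φ : Ω → 𝓛) (P : Measure (𝒳 × Label)) : EReal :=
  ⨅ f : {f : 𝒳 → ℝ // Measurable f}, ensembleRisk μ Φ P f.1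

end RandomLoss

/-! By Fubini the ensemble risk is the surrogate risk of the single deterministic loss `F z = E
Φ(z)`, and `F` is again convex, bounded below and differentiable at `0` with `F' 0 < 0`
(`isBCCLoss_expectedLoss`). So it is enough to treat one such loss, with `ψ = calibrationGap F`.

For fixed `α` the gain `F 0 - condRisk F θ α` is affine in `θ`, and `ψ` is the supremum of these
gains. Hence `ψ` is convex and lower semicontinuous. It vanishes at `0` and is positive on `(0, 1]`,
because `condRisk F θ` has slope `θ * F' 0 < 0` at `0`. This makes `ψ` a strictly increasing
bijection.

For the risk bound, let `η` be the regression function and `D` the set where `η * f ≤ 0`. The excess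
misclassification risk is at most `m = E[|η|; D]` (`risk_sub_riskInf_le`). Replacing `f` on `D` by
`±α`, with the sign of `η`, lowers the surrogate risk by at least `F 0 - condRisk F m α`
(`sub_condRisk_disagreementMass_le`), since the pointwise gain is affine in `|η|`. The supremum over
`α` gives `ψ m ≤` excess surrogate risk. One constant `α` at a time suffices, so neither a
measurable choice of conditional minimizers nor a Bayes classifier is needed. -/

/-- The conditional surrogate risk of the score `α` for the loss `F`, when the two labels have
conditional probabilities `(1 + θ) / 2` and `(1 - θ) / 2`. -/
noncomputable def condRisk (F : ℝ → ℝ) (θ α : ℝ) : ℝ :=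
  (1 + θ) / 2 * F α + (1 - θ) / 2 * F (-α)

/-- The function `θ ↦ F 0 - inf_α condRisk F θ α`. -/
noncomputable def calibrationGap (F : ℝ → ℝ) (θ : ℝ) : ℝ :=
  F 0 - ⨅ α : ℝ, condRisk F θ α

/-! ### The calibration gap of a single convex calibrated loss. -/

namespace IsBCCLoss

variable {F : ℝ → ℝ}

theorem continuous (hF : IsBCCLoss F) : Continuous F :=
  continuousOn_univ.1 (hF.convex.continuousOn isOpen_univ)

theorem exists_lower_bound (hF : IsBCCLoss F) : ∃ m, ∀ z, m ≤ F z := by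
  obtain ⟨m, hm⟩ := hF.bddBelow
  exact ⟨m, fun z => hm ⟨z, rfl⟩⟩

theorem zero_le_of_nonpos (hF : IsBCCLoss F) {s : ℝ} (hs : s ≤ 0) : F 0 ≤ F s := by
  rcases hs.eq_or_lt with rfl | hs
  · exact le_rfl
  have h := hF.convex.slope_le_of_hasDerivAt (mem_univ s) (mem_univ 0) hs
    hF.differentiableAt_zero.hasDerivAt
  have h' := h.trans hF.deriv_zero_neg.le
  rw [slope_def_field, div_le_iff₀ (by linarith)] at h'
  linarith

/-- Jensen: the mean margin is `θ * t ≤ 0`, and left of `0` the loss lies above its decreasing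
tangent at `0`. A score of the wrong sign therefore does no better than the score `0`. -/
theorem zero_le_condRisk (hF : IsBCCLoss F) {θ t : ℝ} (h₁ : -1 ≤ θ) (h₂ : θ ≤ 1)
    (ht : θ * t ≤ 0) : F 0 ≤ condRisk F θ t := by
  have h := hF.convex.2 (mem_univ t) (mem_univ (-t)) (show 0 ≤ (1 + θ) / 2 by linarith)
    (show 0 ≤ (1 - θ) / 2 by linarith) (by ring)
  simp only [smul_eq_mul] at h
  have e : (1 + θ) / 2 * t + (1 - θ) / 2 * -t = θ * t := by ring
  rw [e] at h
  exact (hF.zero_le_of_nonpos ht).trans h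

theorem bddBelow_condRisk (hF : IsBCCLoss F) {θ : ℝ} (h₁ : -1 ≤ θ) (h₂ : θ ≤ 1) :
    BddBelow (range (condRisk F θ)) := by
  obtain ⟨m, hm⟩ := hF.exists_lower_bound
  refine ⟨m, ?_⟩
  rintro _ ⟨α, rfl⟩
  have a := mul_le_mul_of_nonneg_left (hm α) (show 0 ≤ (1 + θ) / 2 by linarith)
  have b := mul_le_mul_of_nonneg_left (hm (-α)) (show 0 ≤ (1 - θ) / 2 by linarith)
  unfold condRisk
  linarith

theorem sub_condRisk_le (hF : IsBCCLoss F) {θ : ℝ} (hθ : θ ∈ Icc (0 : ℝ) 1) (α : ℝ) :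
    F 0 - condRisk F θ α ≤ calibrationGap F θ :=
  sub_le_sub_left (ciInf_le (hF.bddBelow_condRisk (by linarith [hθ.1]) hθ.2) α) _

theorem calibrationGap_le_iff (hF : IsBCCLoss F) {θ : ℝ} (hθ : θ ∈ Icc (0 : ℝ) 1) {t : ℝ} :
    calibrationGap F θ ≤ t ↔ ∀ α, F 0 - condRisk F θ α ≤ t := by
  refine ⟨fun h α => (hF.sub_condRisk_le hθ α).trans h, fun h => ?_⟩
  have : F 0 - t ≤ ⨅ α : ℝ, condRisk F θ α := le_ciInf fun α => by linarith [h α]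
  unfold calibrationGap
  linarith

theorem convexOn_calibrationGap (hF : IsBCCLoss F) :
    ConvexOn ℝ (Icc 0 1) (calibrationGap F) := by
  refine ⟨convex_Icc 0 1, fun x hx y hy a b ha hb hab => ?_⟩
  refine (hF.calibrationGap_le_iff (convex_Icc 0 1 hx hy ha hb hab)).2 fun α => ?_
  have h₁ := mul_le_mul_of_nonneg_left (hF.sub_condRisk_le hx α) ha
  have h₂ := mul_le_mul_of_nonneg_left (hF.sub_condRisk_le hy α) hb
  simp only [smul_eq_mul]
  refine le_trans (le_of_eq ?_) (add_le_add h₁ h₂)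
  obtain rfl : b = 1 - a := by linarith
  unfold condRisk
  ring

theorem calibrationGap_zero (hF : IsBCCLoss F) : calibrationGap F 0 = 0 := by
  have h0 : (0 : ℝ) ∈ Icc (0 : ℝ) 1 := by simp
  refine le_antisymm ((hF.calibrationGap_le_iff h0).2 fun α => ?_) ?_
  · linarith [hF.zero_le_condRisk (θ := 0) (t := α) (by simp) (by simp) (by simp)]
  · have := hF.sub_condRisk_le h0 0
    simp only [condRisk, neg_zero] at this
    linarith

theorem calibrationGap_pos (hF : IsBCCLoss F) {θ : ℝ} (hθ : θ ∈ Icc (0 : ℝ) 1) (h : 0 < θ) :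
    0 < calibrationGap F θ := by
  by_contra! hle
  -- A gap `≤ 0` would make `0` a minimizer of `condRisk F θ`, whose derivative there is `θ * F' 0 ≠
  -- 0`.
  have hmin : IsLocalMin (condRisk F θ) 0 := Eventually.of_forall fun α => by
    have := (hF.calibrationGap_le_iff hθ).1 hle α
    have e : condRisk F θ 0 = F 0 := by simp only [condRisk, neg_zero]; ring
    linarith
  have hd := hF.differentiableAt_zero.hasDerivAt
  have hd' : HasDerivAt (fun α => F (-α)) (deriv F 0 * -1) 0 := by
    refine HasDerivAt.comp (h₂ := F) 0 ?_ (hasDerivAt_neg 0)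
    simpa using hd
  have hc : HasDerivAt (condRisk F θ)
      ((1 + θ) / 2 * deriv F 0 + (1 - θ) / 2 * (deriv F 0 * -1)) 0 :=
    (hd.const_mul _).add (hd'.const_mul _)
  have := hmin.hasDerivAt_eq_zero hc
  nlinarith [hF.deriv_zero_neg]

theorem strictMonoOn_calibrationGap (hF : IsBCCLoss F) :
    StrictMonoOn (calibrationGap F) (Icc 0 1) := by
  intro x hx y hy hxy
  have hy0 : 0 < y := hx.1.trans_lt hxy
  have hr : x / y < 1 := (div_lt_one hy0).2 hxy
  have h := hF.convexOn_calibrationGap.2 (show (0 : ℝ) ∈ Icc (0 : ℝ) 1 by simp) hy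
    (show 0 ≤ 1 - x / y by linarith) (div_nonneg hx.1 hy0.le) (by ring)
  simp only [smul_eq_mul, mul_zero, zero_add, hF.calibrationGap_zero,
    div_mul_cancel₀ x hy0.ne'] at h
  have := hF.calibrationGap_pos hy hy0
  nlinarith

/-- Lower semicontinuity of a supremum of affine functions. It supplies what convexity alone does
not give at the endpoints of `[0, 1]`. -/
theorem isClosed_sublevel_calibrationGap (hF : IsBCCLoss F) (t : ℝ) :
    IsClosed {θ | θ ∈ Icc (0 : ℝ) 1 ∧ calibrationGap F θ ≤ t} := by
  have e : {θ | θ ∈ Icc (0 : ℝ) 1 ∧ calibrationGap F θ ≤ t}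
      = Icc (0 : ℝ) 1 ∩ ⋂ α, {θ | F 0 - condRisk F θ α ≤ t} := by
    ext θ
    simp only [mem_ofPred_eq, mem_inter_iff, mem_iInter]
    exact and_congr_right fun hθ => hF.calibrationGap_le_iff hθ
  rw [e]
  refine isClosed_Icc.inter (isClosed_iInter fun α => isClosed_le ?_ continuous_const)
  unfold condRisk
  fun_prop

theorem surjOn_calibrationGap (hF : IsBCCLoss F) :
    SurjOn (calibrationGap F) (Icc 0 1) (Icc 0 (calibrationGap F 1)) := by
  intro t ht
  set S := {θ | θ ∈ Icc (0 : ℝ) 1 ∧ calibrationGap F θ ≤ t} with hS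
  have hcomp : IsCompact S :=
    isCompact_Icc.of_isClosed_subset (hF.isClosed_sublevel_calibrationGap t) fun θ h => h.1
  have hmem : sSup S ∈ S :=
    hcomp.sSup_mem ⟨0, by simp, by rw [hF.calibrationGap_zero]; exact ht.1⟩
  set θ := sSup S
  refine ⟨θ, hmem.1, hmem.2.eq_of_not_lt fun hlt => ?_⟩
  have hd : 0 < calibrationGap F 1 - calibrationGap F θ := by linarith [ht.2]
  have hθ1 : θ < 1 := hmem.1.2.lt_of_ne fun h => by rw [h] at hd; simp at hd
  -- The chord from `θ` to `1` reaches the height `t` at the parameter `ε`. By convexity that point,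
  -- strictly right of `θ`, still lies in `S`, against the maximality of `θ`.
  set ε := (t - calibrationGap F θ) / (calibrationGap F 1 - calibrationGap F θ) with hε
  have hε0 : 0 < ε := div_pos (by linarith) hd
  have hε1 : ε ≤ 1 := (div_le_one hd).2 (by linarith [ht.2])
  have hεm : ε * (calibrationGap F 1 - calibrationGap F θ) = t - calibrationGap F θ :=
    div_mul_cancel₀ _ hd.ne'
  have h1 : (1 : ℝ) ∈ Icc (0 : ℝ) 1 := by simp
  have hconv := hF.convexOn_calibrationGap.2 hmem.1 h1 (show 0 ≤ 1 - ε by linarith) hε0.le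
    (by ring)
  have hin := convex_Icc (0 : ℝ) 1 hmem.1 h1 (show 0 ≤ 1 - ε by linarith) hε0.le (by ring)
  simp only [smul_eq_mul] at hconv hin
  have hle : (1 - ε) * θ + ε * 1 ≤ θ :=
    le_csSup hcomp.bddAbove ⟨hin, hconv.trans (by linarith)⟩
  nlinarith

theorem bijOn_calibrationGap (hF : IsBCCLoss F) :
    BijOn (calibrationGap F) (Icc 0 1) (Icc 0 (calibrationGap F 1)) := by
  refine ⟨fun θ hθ => ?_, hF.strictMonoOn_calibrationGap.injOn, hF.surjOn_calibrationGap⟩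
  have hm := hF.strictMonoOn_calibrationGap.monotoneOn
  refine ⟨?_, hm hθ (by simp) hθ.2⟩
  rw [← hF.calibrationGap_zero]
  exact hm (by simp) hθ hθ.1

end IsBCCLoss

/-! ### The expected loss inherits convexity and calibration. -/

section ExpectedLoss

variable {Ω : Type*} [MeasurableSpace Ω] {μ : Measure Ω} {𝓛 : Set (ℝ → ℝ)} {Φ : Ω → 𝓛}

/-- The expected loss `z ↦ E Φ(z)` of a random loss. -/
noncomputable def expectedLoss (μ : Measure Ω) (Φ : Ω → 𝓛) (z : ℝ) : ℝ :=
  ∫ ω, (Φ ω : ℝ → ℝ) z ∂μ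

/-- Secant slopes of a convex function are monotone, so this one lies between the slopes from `-1`
to `0` and from `0` to `1`. For a random loss the bound is integrable and dominates all difference
quotients near `0`. -/
theorem abs_slope_zero_le {φ : ℝ → ℝ} (hφ : ConvexOn ℝ univ φ) {h : ℝ} (h0 : h ≠ 0)
    (h1 : |h| ≤ 1) : |slope φ 0 h| ≤ |φ 0 - φ (-1)| + |φ 1 - φ 0| := by
  obtain ⟨hl, hr⟩ := abs_le.1 h1
  have a := hφ.secant_mono (mem_univ 0) (mem_univ (-1)) (mem_univ h) (by norm_num) h0 hl
  have b := hφ.secant_mono (mem_univ 0) (mem_univ h) (mem_univ 1) h0 (by norm_num) hr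
  rw [slope_def_field, abs_le]
  norm_num at a b
  simp only [sub_zero]
  constructor
  · linarith [neg_abs_le (φ 0 - φ (-1)), abs_nonneg (φ 1 - φ 0)]
  · linarith [le_abs_self (φ 1 - φ 0), abs_nonneg (φ 0 - φ (-1))]

theorem hasDerivAt_expectedLoss_zero (h𝓛 : ∀ φ ∈ 𝓛, IsBCCLoss φ)
    (hint : ∀ z : ℝ, Integrable (fun ω => (Φ ω : ℝ → ℝ) z) μ) :
    Integrable (fun ω => deriv (Φ ω : ℝ → ℝ) 0) μ ∧
      HasDerivAt (expectedLoss μ Φ) (∫ ω, deriv (Φ ω : ℝ → ℝ) 0 ∂μ) 0 := by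
  have hslope : ∀ z, Integrable (fun ω => slope (Φ ω : ℝ → ℝ) 0 z) μ := fun z => by
    simp only [slope_def_field]
    exact ((hint z).sub (hint 0)).div_const _
  have hbound : Integrable (fun ω => |(Φ ω : ℝ → ℝ) 0 - (Φ ω : ℝ → ℝ) (-1)|
      + |(Φ ω : ℝ → ℝ) 1 - (Φ ω : ℝ → ℝ) 0|) μ :=
    ((hint 0).sub (hint (-1))).abs.add ((hint 1).sub (hint 0)).abs
  have htend : ∀ ω, Tendsto (fun z => slope (Φ ω : ℝ → ℝ) 0 z) (𝓝[≠] 0)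
      (𝓝 (deriv (Φ ω : ℝ → ℝ) 0)) := fun ω =>
    hasDerivAt_iff_tendsto_slope.1 (h𝓛 _ (Φ ω).2).differentiableAt_zero.hasDerivAt
  have hev : ∀ᶠ z : ℝ in 𝓝[≠] 0, z ≠ 0 ∧ |z| ≤ 1 := by
    refine (eventually_mem_nhdsWithin).and (eventually_nhdsWithin_of_eventually_nhds ?_)
    filter_upwards [Metric.ball_mem_nhds (0 : ℝ) one_pos] with z hz
    simpa using (Metric.mem_ball.1 hz).le
  constructor
  · refine hbound.mono' (aestronglyMeasurable_of_tendsto_ae (𝓝[≠] (0 : ℝ))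
      (fun z => (hslope z).1) (Eventually.of_forall htend)) (Eventually.of_forall fun ω => ?_)
    refine le_of_tendsto (htend ω).norm ?_
    filter_upwards [hev] with z hz
    exact abs_slope_zero_le (h𝓛 _ (Φ ω).2).convex hz.1 hz.2
  · rw [hasDerivAt_iff_tendsto_slope]
    have key := tendsto_integral_filter_of_dominated_convergence (μ := μ) (l := 𝓝[≠] (0 : ℝ))
      (F := fun z ω => slope (Φ ω : ℝ → ℝ) 0 z) _
      (Eventually.of_forall fun z => (hslope z).1)
      (hev.mono fun z hz => Eventually.of_forall fun ω =>
        abs_slope_zero_le (h𝓛 _ (Φ ω).2).convex hz.1 hz.2)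
      hbound (Eventually.of_forall htend)
    refine key.congr fun z => ?_
    simp only [slope_def_field, expectedLoss]
    rw [integral_div, integral_sub (hint z) (hint 0)]

theorem RandomLossAssumption.isBCCLoss_expectedLoss [IsProbabilityMeasure μ]
    (h𝓛 : ∀ φ ∈ 𝓛, IsBCCLoss φ) (hA : RandomLossAssumption μ Φ) :
    IsBCCLoss (expectedLoss μ Φ) := by
  have hint := hA.integrable_eval
  obtain ⟨hI, hD⟩ := hasDerivAt_expectedLoss_zero h𝓛 hint
  refine ⟨⟨convex_univ, fun x _ y _ a b ha hb hab => ?_⟩, ?_, hD.differentiableAt, ?_⟩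
  · simp only [expectedLoss, smul_eq_mul]
    rw [← integral_const_mul, ← integral_const_mul,
      ← integral_add ((hint x).const_mul a) ((hint y).const_mul b)]
    exact integral_mono (hint _) (((hint x).const_mul a).add ((hint y).const_mul b)) fun ω =>
      (h𝓛 _ (Φ ω).2).convex.2 (mem_univ x) (mem_univ y) ha hb hab
  · obtain ⟨U, hU, hle⟩ := hA.exists_lower_bound
    refine ⟨∫ ω, U ω ∂μ, ?_⟩
    rintro _ ⟨z, rfl⟩
    exact integral_mono_ae hU (hint z) (hle z)
  · rw [hD.deriv, ← neg_pos, ← integral_neg]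
    have hneg : ∀ ω, 0 < -deriv (Φ ω : ℝ → ℝ) 0 := fun ω =>
      neg_pos.2 (h𝓛 _ (Φ ω).2).deriv_zero_neg
    -- Strict negativity survives integration because the integrand is nonzero everywhere and `μ`
    -- has mass one.
    rw [integral_pos_iff_support_of_nonneg (fun ω => (hneg ω).le) hI.neg]
    have : Function.support (fun ω => -deriv (Φ ω : ℝ → ℝ) 0) = univ :=
      eq_univ_of_forall fun ω => (hneg ω).ne'
    simp [this]

theorem psi_eq_calibrationGap (hint : ∀ z : ℝ, Integrable (fun ω => (Φ ω : ℝ → ℝ) z) μ) :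
    psi μ Φ = calibrationGap (expectedLoss μ Φ) := by
  funext θ
  simp only [psi, calibrationGap, condRisk, expectedLoss]
  congr 2
  funext α
  rw [integral_add ((hint α).const_mul _) ((hint (-α)).const_mul _), integral_const_mul,
    integral_const_mul]

end ExpectedLoss

/-! ### The two-point label space. -/

theorem measurableSet_isLabel : MeasurableSet {y : ℝ | y = 1 ∨ y = -1} :=
  (measurableSet_singleton (1 : ℝ)).union (measurableSet_singleton (-1 : ℝ))

-- Disintegrating `P` along `X` requires regularity of the label space only, so `𝒳` can stay
-- arbitrary.
instance : StandardBorelSpace Label := measurableSet_isLabel.standardBorel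

/-- The label `+1`. -/
def Label.pos : Label := ⟨1, Or.inl rfl⟩

/-- The label `-1`. -/
def Label.neg : Label := ⟨-1, Or.inr rfl⟩

instance : Nonempty Label := ⟨Label.pos⟩

theorem Label.neg_ne_pos : Label.neg ≠ Label.pos := fun h => by
  have := congrArg Subtype.val h
  norm_num [Label.neg, Label.pos] at this

theorem Label.eq_pos_or_eq_neg (y : Label) : y = Label.pos ∨ y = Label.neg := by
  rcases y with ⟨y, rfl | rfl⟩
  · exact Or.inl rfl
  · exact Or.inr rfl

theorem Label.compl_singleton_pos : ({Label.pos}ᶜ : Set Label) = {Label.neg} := by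
  ext y
  rcases y.eq_pos_or_eq_neg with rfl | rfl
  · simp [Label.neg_ne_pos.symm]
  · simp [Label.neg_ne_pos]

theorem integral_label (κ : Measure Label) [IsProbabilityMeasure κ] (g : Label → ℝ) :
    ∫ y, g y ∂κ = κ.real {Label.pos} * g Label.pos + (1 - κ.real {Label.pos}) * g Label.neg := by
  have hfin : Finite Label := Finite.of_finite_univ <|
    (Set.toFinite {Label.pos, Label.neg}).subset fun y _ => y.eq_pos_or_eq_neg
  have hI : Integrable g κ := Integrable.of_finite
  have hm : MeasurableSet ({Label.pos} : Set Label) := measurableSet_singleton _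
  rw [← integral_add_compl hm hI, Label.compl_singleton_pos, integral_singleton,
    integral_singleton, ← Label.compl_singleton_pos, probReal_compl_eq_one_sub hm, smul_eq_mul,
    smul_eq_mul]

theorem measurable_predict (s₀ : Label) : Measurable (predict s₀) :=
  Measurable.ite measurableSet_Ioi measurable_const
    (Measurable.ite measurableSet_Iio measurable_const measurable_const)

/-! ### Expectations with values in `(-∞, +∞]`. -/

section ExtExpectation

variable {α : Type*} [MeasurableSpace α] {P : Measure α} {g : α → ℝ}

theorem extExpectation_of_integrable (hg : Integrable g P) :
    extExpectation P g = ((∫ a, g a ∂P : ℝ) : EReal) := by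
  have h₁ : ∫⁻ a, ENNReal.ofReal (g a) ∂P ≠ ⊤ := hg.lintegral_lt_top.ne
  have h₂ : ∫⁻ a, ENNReal.ofReal (-g a) ∂P ≠ ⊤ := hg.neg.lintegral_lt_top.ne
  rw [integral_eq_lintegral_pos_part_sub_lintegral_neg_part hg, EReal.coe_sub, extExpectation,
    EReal.coe_ennreal_toReal h₁, EReal.coe_ennreal_toReal h₂]

variable [IsProbabilityMeasure P]

theorem extExpectation_eq_top_of_not_integrable (hm : Measurable g) {m : ℝ} (hb : ∀ a, m ≤ g a)
    (hg : ¬ Integrable g P) : extExpectation P g = ⊤ := by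
  have h₂ : ∫⁻ a, ENNReal.ofReal (-g a) ∂P ≠ ⊤ := by
    refine ne_top_of_le_ne_top (b := ∫⁻ _, ENNReal.ofReal (-m) ∂P) (by simp) ?_
    exact lintegral_mono fun a => ENNReal.ofReal_le_ofReal (neg_le_neg (hb a))
  have h₁ : ∫⁻ a, ENNReal.ofReal (g a) ∂P = ⊤ := by
    by_contra h
    refine hg ⟨hm.aestronglyMeasurable, ?_⟩
    rw [hasFiniteIntegral_iff_norm]
    have hle : ∫⁻ a, ENNReal.ofReal ‖g a‖ ∂P
        ≤ ∫⁻ a, (ENNReal.ofReal (g a) + ENNReal.ofReal (-g a)) ∂P := by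
      refine lintegral_mono fun a => ?_
      rcases le_total 0 (g a) with h0 | h0
      · simp [abs_of_nonneg h0]
      · simp [abs_of_nonpos h0]
    refine hle.trans_lt ?_
    rw [lintegral_add_left hm.ennreal_ofReal]
    exact ENNReal.add_lt_top.2 ⟨lt_top_iff_ne_top.2 h, lt_top_iff_ne_top.2 h₂⟩
  rw [extExpectation, h₁, ← EReal.coe_ennreal_toReal h₂]
  simp

theorem le_extExpectation (hm : Measurable g) {m : ℝ} (hb : ∀ a, m ≤ g a) :
    (m : EReal) ≤ extExpectation P g := by
  by_cases hg : Integrable g P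
  · rw [extExpectation_of_integrable hg, EReal.coe_le_coe_iff]
    simpa using integral_mono (μ := P) (integrable_const m) hg hb
  · rw [extExpectation_eq_top_of_not_integrable hm hb hg]
    exact le_top

end ExtExpectation

theorem riskInf_le {𝒳 : Type*} [MeasurableSpace 𝒳] {P : Measure (𝒳 × Label)} (s₀ : Label)
    {f : 𝒳 → ℝ} (hf : Measurable f) : riskInf s₀ P ≤ risk s₀ P f :=
  ciInf_le (f := fun f : {f : 𝒳 → ℝ // Measurable f} => risk s₀ P f.1)
    ⟨0, by rintro _ ⟨g, rfl⟩; exact measureReal_nonneg⟩ ⟨f, hf⟩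

/-! ### The regression function and the excess misclassification risk. -/

section Regression

variable {𝒳 : Type*} [MeasurableSpace 𝒳] (P : Measure (𝒳 × Label)) [IsProbabilityMeasure P]

/-- The regression function `x ↦ E[Y | X = x] = 2 P(Y = 1 | X = x) - 1`. -/
noncomputable def regression (x : 𝒳) : ℝ :=
  2 * (P.condKernel x).real {Label.pos} - 1

theorem measurable_regression : Measurable (regression P) :=
  (((P.condKernel).measurable_coe (measurableSet_singleton _)).ennreal_toReal.const_mul
    2).sub_const 1

theorem neg_one_le_regression (x : 𝒳) : -1 ≤ regression P x := by
  have : 0 ≤ (P.condKernel x).real {Label.pos} := measureReal_nonneg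
  unfold regression
  linarith

theorem regression_le_one (x : 𝒳) : regression P x ≤ 1 := by
  have : (P.condKernel x).real {Label.pos} ≤ 1 := measureReal_le_one
  unfold regression
  linarith

theorem abs_regression_le_one (x : 𝒳) : |regression P x| ≤ 1 :=
  abs_le.2 ⟨neg_one_le_regression P x, regression_le_one P x⟩

theorem integral_condKernel_eq_regression (g : 𝒳 × Label → ℝ) (x : 𝒳) :
    ∫ y, g (x, y) ∂P.condKernel x = (1 + regression P x) / 2 * g (x, Label.pos)
      + (1 - regression P x) / 2 * g (x, Label.neg) := by
  rw [integral_label]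
  unfold regression
  ring

variable {P}

theorem integral_eq_integral_regression {g : 𝒳 × Label → ℝ} (hg : Integrable g P) :
    ∫ p, g p ∂P = ∫ x, ((1 + regression P x) / 2 * g (x, Label.pos)
      + (1 - regression P x) / 2 * g (x, Label.neg)) ∂P.fst := by
  simp_rw [← integral_condKernel_eq_regression P g]
  exact (Measure.integral_condKernel hg).symm

theorem integrable_regression {g : 𝒳 × Label → ℝ} (hg : Integrable g P) :
    Integrable (fun x => (1 + regression P x) / 2 * g (x, Label.pos)
      + (1 - regression P x) / 2 * g (x, Label.neg)) P.fst := by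
  simp_rw [← integral_condKernel_eq_regression P g]
  exact hg.integral_condKernel

theorem measurableSet_misclassified (s₀ : Label) {f : 𝒳 → ℝ} (hf : Measurable f) :
    MeasurableSet {p : 𝒳 × Label | predict s₀ (f p.1) ≠ p.2} :=
  (measurableSet_eq_fun ((measurable_predict s₀).comp (hf.comp measurable_fst))
    measurable_snd).compl

theorem risk_eq_integral (s₀ : Label) {f : 𝒳 → ℝ} (hf : Measurable f) :
    Integrable (fun x => (1 + regression P x) / 2 * (if predict s₀ (f x) = Label.pos then 0 else 1)
      + (1 - regression P x) / 2 * (if predict s₀ (f x) = Label.pos then 1 else 0)) P.fst ∧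
    risk s₀ P f = ∫ x, ((1 + regression P x) / 2 * (if predict s₀ (f x) = Label.pos then 0 else 1)
      + (1 - regression P x) / 2 * (if predict s₀ (f x) = Label.pos then 1 else 0)) ∂P.fst := by
  have hm := measurableSet_misclassified s₀ hf
  have hI : Integrable ({p : 𝒳 × Label | predict s₀ (f p.1) ≠ p.2}.indicator (1 : 𝒳 × Label → ℝ)) P :=
    (integrable_const (1 : ℝ)).indicator hm
  have e : (fun x => (1 + regression P x) / 2 * (if predict s₀ (f x) = Label.pos then 0 else 1)
      + (1 - regression P x) / 2 * (if predict s₀ (f x) = Label.pos then (1 : ℝ) else 0)) =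
      fun x => (1 + regression P x) / 2 *
        ({p : 𝒳 × Label | predict s₀ (f p.1) ≠ p.2}.indicator (1 : 𝒳 × Label → ℝ)) (x, Label.pos)
      + (1 - regression P x) / 2 *
        ({p : 𝒳 × Label | predict s₀ (f p.1) ≠ p.2}.indicator (1 : 𝒳 × Label → ℝ)) (x, Label.neg) := by
    funext x
    rcases (predict s₀ (f x)).eq_pos_or_eq_neg with h | h <;>
      simp [indicator, h, Label.neg_ne_pos, Label.neg_ne_pos.symm]
  refine ⟨e ▸ integrable_regression hI, ?_⟩
  rw [e, ← integral_eq_integral_regression hI, integral_indicator_one hm]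
  rfl

theorem integrable_abs_regression : Integrable (fun x => |regression P x|) P.fst :=
  (integrable_const (1 : ℝ)).mono' (measurable_regression P).abs.aestronglyMeasurable
    (Eventually.of_forall fun x => by simpa using abs_regression_le_one P x)

/-- Given `X = x`, either prediction errs with probability at least `(1 - |η x|) / 2`, the smaller
of the two conditional label probabilities. -/
theorem le_risk (s₀ : Label) {f : 𝒳 → ℝ} (hf : Measurable f) :
    ∫ x, (1 - |regression P x|) / 2 ∂P.fst ≤ risk s₀ P f := by
  obtain ⟨hI, he⟩ := risk_eq_integral (P := P) s₀ hf
  rw [he]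
  refine integral_mono (((integrable_const 1).sub integrable_abs_regression).div_const 2) hI
    fun x => ?_
  have h₁ := le_abs_self (regression P x)
  have h₂ := neg_abs_le (regression P x)
  dsimp only
  split_ifs <;> linarith

theorem le_riskInf (s₀ : Label) :
    ∫ x, (1 - |regression P x|) / 2 ∂P.fst ≤ riskInf s₀ P := by
  have : Nonempty {f : 𝒳 → ℝ // Measurable f} := ⟨⟨_, measurable_const (a := (0 : ℝ))⟩⟩
  exact le_ciInf fun f => le_risk s₀ f.2

/-- The set where the score `f` does not strictly agree in sign with the regression function. -/
def disagreement (P : Measure (𝒳 × Label)) [IsProbabilityMeasure P] (f : 𝒳 → ℝ) : Set 𝒳 :=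
  {x | regression P x * f x ≤ 0}

theorem measurableSet_disagreement {f : 𝒳 → ℝ} (hf : Measurable f) :
    MeasurableSet (disagreement P f) :=
  measurableSet_le ((measurable_regression P).mul hf) measurable_const

/-- The expectation of `|E[Y | X]|` over the event that `f(X)` and `E[Y | X]` do not strictly
agree in sign. -/
noncomputable def disagreementMass (P : Measure (𝒳 × Label)) [IsProbabilityMeasure P]
    (f : 𝒳 → ℝ) : ℝ :=
  ∫ x, (disagreement P f).indicator (fun x => |regression P x|) x ∂P.fst

theorem disagreementMass_mem_Icc (f : 𝒳 → ℝ) : disagreementMass P f ∈ Icc (0 : ℝ) 1 := by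
  refine ⟨integral_nonneg fun x => indicator_nonneg (fun _ _ => abs_nonneg _) x, ?_⟩
  have h := integral_mono_of_nonneg (μ := P.fst)
    (f := (disagreement P f).indicator fun x => |regression P x|)
    (Eventually.of_forall fun x => indicator_nonneg (fun _ _ => abs_nonneg _) x)
    (integrable_const (1 : ℝ)) (Eventually.of_forall fun x =>
      (indicator_le_self' (fun _ _ => abs_nonneg _) x).trans (abs_regression_le_one P x))
  simpa [disagreementMass] using h

theorem predict_eq_pos_iff_of_ne_zero (s₀ : Label) {t : ℝ} (ht : t ≠ 0) :
    predict s₀ t = Label.pos ↔ 0 < t := by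
  rcases ht.lt_or_gt with h | h
  · have : predict s₀ t = Label.neg := by simp [predict, h, h.not_gt, Label.neg]
    simp [this, Label.neg_ne_pos, h.le]
  · simp [predict, h, Label.pos]

/-- Off the disagreement set the conditional error is the optimal `(1 - |η|) / 2`; on it the error
exceeds this by at most `|η|`. Zero scores belong to the disagreement set, so the value `s₀` plays
no role. -/
theorem risk_sub_riskInf_le (s₀ : Label) {f : 𝒳 → ℝ} (hf : Measurable f) :
    risk s₀ P f - riskInf s₀ P ≤ disagreementMass P f := by
  have hB : Integrable (fun x => (1 - |regression P x|) / 2) P.fst :=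
    ((integrable_const 1).sub integrable_abs_regression).div_const 2
  have hD : Integrable ((disagreement P f).indicator fun x => |regression P x|) P.fst :=
    integrable_abs_regression.indicator (measurableSet_disagreement hf)
  suffices h : risk s₀ P f ≤ (∫ x, (1 - |regression P x|) / 2 ∂P.fst) + disagreementMass P f by
    linarith [le_riskInf (P := P) s₀]
  obtain ⟨hI, he⟩ := risk_eq_integral (P := P) s₀ hf
  rw [he, disagreementMass, ← integral_add hB hD]
  refine integral_mono hI (hB.add hD) fun x => ?_
  have h₁ := le_abs_self (regression P x)
  have h₂ := neg_abs_le (regression P x)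
  by_cases hx : x ∈ disagreement P f
  · simp only [indicator_of_mem hx]
    split_ifs <;> linarith
  · simp only [indicator_of_notMem hx]
    have hx' : 0 < regression P x * f x := not_le.1 hx
    simp only [predict_eq_pos_iff_of_ne_zero s₀ (right_ne_zero_of_mul hx'.ne')]
    rcases pos_and_pos_or_neg_and_neg_of_mul_pos hx' with ⟨ha, hb⟩ | ⟨ha, hb⟩
    · simp only [hb, if_true, abs_of_pos ha]
      linarith
    · simp only [hb.not_gt, if_false, abs_of_neg ha]
      linarith

end Regression

/-! ### Correcting a score on the disagreement set. -/

section ExcessRisk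

variable {𝒳 : Type*} [MeasurableSpace 𝒳] {P : Measure (𝒳 × Label)} [IsProbabilityMeasure P]
  {F : ℝ → ℝ} {f : 𝒳 → ℝ} {α : ℝ}

/-- The score `f`, replaced by `±α` with the sign of the regression function wherever the two do
not strictly agree in sign. -/
noncomputable def correctedScore (P : Measure (𝒳 × Label)) [IsProbabilityMeasure P] (f : 𝒳 → ℝ)
    (α : ℝ) (x : 𝒳) : ℝ :=
  open Classical in
  if x ∈ disagreement P f then (if 0 ≤ regression P x then α else -α) else f x

theorem measurable_correctedScore (hf : Measurable f) : Measurable (correctedScore P f α) := by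
  classical
  exact Measurable.ite (measurableSet_disagreement hf)
    (Measurable.ite (measurableSet_le measurable_const (measurable_regression P))
      measurable_const measurable_const) hf

theorem condRisk_neg (F : ℝ → ℝ) (θ α : ℝ) : condRisk F θ (-α) = condRisk F (-θ) α := by
  simp only [condRisk, neg_neg]
  ring

theorem condRisk_correctedScore {x : 𝒳} (hx : x ∈ disagreement P f) :
    condRisk F (regression P x) (correctedScore P f α x) = condRisk F |regression P x| α := by
  simp only [correctedScore, hx, if_true]
  split_ifs with h
  · rw [abs_of_nonneg h]
  · rw [condRisk_neg, abs_of_neg (not_le.1 h)]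

theorem measurable_margin (hf : Measurable f) :
    Measurable fun p : 𝒳 × Label => (p.2 : ℝ) * f p.1 :=
  (measurable_subtype_coe.comp measurable_snd).mul (hf.comp measurable_fst)

theorem integrable_correctedScore (hF : IsBCCLoss F) (hf : Measurable f)
    (hI : Integrable (fun p : 𝒳 × Label => F (p.2 * f p.1)) P) :
    Integrable (fun p : 𝒳 × Label => F (p.2 * correctedScore P f α p.1)) P := by
  refine (hI.abs.add (integrable_const (|F α| + |F (-α)|))).mono'
    (hF.continuous.measurable.comp
      (measurable_margin (measurable_correctedScore hf))).aestronglyMeasurable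
    (Eventually.of_forall fun p => ?_)
  have h₁ := abs_nonneg (F α)
  have h₂ := abs_nonneg (F (-α))
  have h₃ := abs_nonneg (F (p.2 * f p.1))
  simp only [Real.norm_eq_abs, Pi.add_apply, correctedScore]
  split_ifs
  · rcases p.2.eq_pos_or_eq_neg with h | h <;> rw [h] at h₃ ⊢ <;>
      simp only [Label.pos, Label.neg, one_mul, neg_mul] at h₃ ⊢ <;> linarith
  · rcases p.2.eq_pos_or_eq_neg with h | h <;> rw [h] at h₃ ⊢ <;>
      simp only [Label.pos, Label.neg, one_mul, neg_mul, neg_neg] at h₃ ⊢ <;> linarith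
  · linarith

/-- On the disagreement set the pointwise gain is at least `a + b * |η|`, because there `f` is no
better than `0`. Elsewhere the gain is `0 ≥ a`. Integrating the affine lower bound evaluates it at
the disagreement mass. -/
theorem sub_condRisk_disagreementMass_le (hF : IsBCCLoss F) (hf : Measurable f)
    (hI : Integrable (fun p : 𝒳 × Label => F (p.2 * f p.1)) P) (α : ℝ) :
    F 0 - condRisk F (disagreementMass P f) α ≤
      ∫ p : 𝒳 × Label, F (p.2 * f p.1) ∂P
        - ∫ p : 𝒳 × Label, F (p.2 * correctedScore P f α p.1) ∂P := by
  have hI' := integrable_correctedScore (α := α) hF hf hI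
  have hM := measurableSet_disagreement (P := P) hf
  have hD : Integrable ((disagreement P f).indicator fun x => |regression P x|) P.fst :=
    integrable_abs_regression.indicator hM
  have hS : Integrable (fun p : 𝒳 × Label =>
      F (p.2 * f p.1) - F (p.2 * correctedScore P f α p.1)) P := hI.sub hI'
  rw [← integral_sub hI hI', integral_eq_integral_regression hS]
  set a := F 0 - (F α + F (-α)) / 2 with ha
  set b := (F (-α) - F α) / 2 with hb
  -- The sign of `a` is Jensen at `θ = 0`; it is what makes the affine bound valid where the score
  -- is left unchanged.
  have ha0 : a ≤ 0 := by
    have := hF.zero_le_condRisk (θ := 0) (t := α) (by simp) (by simp) (by simp)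
    simp only [condRisk] at this
    linarith
  have e : ∀ θ, F 0 - condRisk F θ α = a + b * θ := fun θ => by
    simp only [condRisk, ha, hb]
    ring
  have hE : F 0 - condRisk F (disagreementMass P f) α
      = ∫ x, (a + b * (disagreement P f).indicator (fun x => |regression P x|) x) ∂P.fst := by
    rw [integral_add (integrable_const a) (hD.const_mul b), integral_const_mul, e]
    simp [disagreementMass]
  rw [hE]
  refine integral_mono ((integrable_const a).add (hD.const_mul b))
    (integrable_regression hS) fun x => ?_
  have hR : (1 + regression P x) / 2 *
        (F (Label.pos * f x) - F (Label.pos * correctedScore P f α x))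
      + (1 - regression P x) / 2 *
        (F (Label.neg * f x) - F (Label.neg * correctedScore P f α x))
      = condRisk F (regression P x) (f x)
        - condRisk F (regression P x) (correctedScore P f α x) := by
    simp only [Label.pos, Label.neg, one_mul, neg_mul, condRisk]
    ring
  refine le_of_le_of_eq ?_ hR.symm
  by_cases hx : x ∈ disagreement P f
  · simp only [indicator_of_mem hx]
    rw [condRisk_correctedScore hx, ← e]
    exact sub_le_sub_right (hF.zero_le_condRisk (neg_one_le_regression P x)
      (regression_le_one P x) hx) _
  · have : correctedScore P f α x = f x := by simp [correctedScore, hx]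
    simp only [indicator_of_notMem hx, this]
    linarith

end ExcessRisk

/-! ### The excess risk bound and its consequence for sequences. -/

section EnsembleRisk

variable {𝒳 Ω : Type*} [MeasurableSpace 𝒳] [MeasurableSpace Ω] {μ : Measure Ω}
  {𝓛 : Set (ℝ → ℝ)} {Φ : Ω → 𝓛} {P : Measure (𝒳 × Label)} {f : 𝒳 → ℝ}

theorem ensembleRisk_eq_extExpectation (μ : Measure Ω) (Φ : Ω → 𝓛) (P : Measure (𝒳 × Label))
    (f : 𝒳 → ℝ) :
    ensembleRisk μ Φ P f
      = extExpectation P fun p : 𝒳 × Label => expectedLoss μ Φ (p.2 * f p.1) :=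
  rfl

theorem ensembleRiskInf_le (hf : Measurable f) : ensembleRiskInf μ Φ P ≤ ensembleRisk μ Φ P f :=
  iInf_le (fun f : {f : 𝒳 → ℝ // Measurable f} => ensembleRisk μ Φ P f.1) ⟨f, hf⟩

theorem measurable_expectedLoss_margin (hF : IsBCCLoss (expectedLoss μ Φ)) (hf : Measurable f) :
    Measurable fun p : 𝒳 × Label => expectedLoss μ Φ (p.2 * f p.1) :=
  hF.continuous.measurable.comp (measurable_margin hf)

variable [IsProbabilityMeasure P]

theorem ensembleRiskInf_ne_bot (hF : IsBCCLoss (expectedLoss μ Φ)) :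
    ensembleRiskInf μ Φ P ≠ ⊥ := by
  obtain ⟨m, hm⟩ := hF.exists_lower_bound
  refine ne_bot_of_le_ne_bot (EReal.coe_ne_bot m) (le_iInf fun f => ?_)
  exact le_extExpectation (measurable_expectedLoss_margin hF f.2) fun p => hm _

theorem ensembleRiskInf_ne_top : ensembleRiskInf μ Φ P ≠ ⊤ := by
  refine ne_top_of_le_ne_top ?_ (ensembleRiskInf_le (measurable_const (a := (0 : ℝ))))
  rw [ensembleRisk_eq_extExpectation, extExpectation_of_integrable (by simp)]
  exact EReal.coe_ne_top _

theorem calibrationGap_le_ensembleRisk_sub (hF : IsBCCLoss (expectedLoss μ Φ))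
    (hf : Measurable f) :
    (calibrationGap (expectedLoss μ Φ) (disagreementMass P f) : EReal)
      ≤ ensembleRisk μ Φ P f - ensembleRiskInf μ Φ P := by
  obtain ⟨m, hm⟩ := hF.exists_lower_bound
  have hr := EReal.coe_toReal (ensembleRiskInf_ne_top (μ := μ) (Φ := Φ) (P := P))
    (ensembleRiskInf_ne_bot hF)
  by_cases hI : Integrable (fun p : 𝒳 × Label => expectedLoss μ Φ (p.2 * f p.1)) P
  · rw [ensembleRisk_eq_extExpectation, extExpectation_of_integrable hI, ← hr, ← EReal.coe_sub,
      EReal.coe_le_coe_iff, hF.calibrationGap_le_iff (disagreementMass_mem_Icc f)]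
    intro α
    -- The corrected score is a measurable competitor, so its risk is at least the infimum.
    refine (sub_condRisk_disagreementMass_le hF hf hI α).trans (sub_le_sub_left ?_ _)
    rw [← EReal.coe_le_coe_iff, hr, ← extExpectation_of_integrable
      (integrable_correctedScore hF hf hI), ← ensembleRisk_eq_extExpectation]
    exact ensembleRiskInf_le (measurable_correctedScore hf)
  -- A loss bounded below but not integrable has risk `+∞`, and the infimum is finite, so the excess
  -- is `+∞`.
  · rw [ensembleRisk_eq_extExpectation, extExpectation_eq_top_of_not_integrable
      (measurable_expectedLoss_margin hF hf) (fun p => hm _) hI, ← hr, EReal.top_sub_coe]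
    exact le_top

theorem risk_sub_riskInf_le_psiInv (hF : IsBCCLoss (expectedLoss μ Φ))
    (hψ : psi μ Φ = calibrationGap (expectedLoss μ Φ)) (s₀ : Label) (hf : Measurable f) :
    risk s₀ P f - riskInf s₀ P
      ≤ psiInv μ Φ (ensembleRisk μ Φ P f - ensembleRiskInf μ Φ P) := by
  refine (risk_sub_riskInf_le s₀ hf).trans (le_csSup ⟨1, fun θ hθ => hθ.1.2⟩ ?_)
  exact ⟨disagreementMass_mem_Icc f, hψ ▸ calibrationGap_le_ensembleRisk_sub hF hf⟩

theorem psiInv_le_of_lt (hmono : StrictMonoOn (psi μ Φ) (Icc 0 1)) {t : EReal} {θ : ℝ}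
    (hθ : θ ∈ Icc (0 : ℝ) 1) (ht : t < psi μ Φ θ) : psiInv μ Φ t ≤ θ :=
  -- For `t < 0` the set in `psiInv` is empty and its supremum is `0` by convention, whence the need
  -- for `0 ≤ θ`.
  Real.sSup_le (fun _ h => (hmono.lt_iff_lt h.1 hθ).1
    (EReal.coe_lt_coe_iff.1 (h.2.trans_lt ht)) |>.le) hθ.1

theorem tendsto_risk (hF : IsBCCLoss (expectedLoss μ Φ))
    (hψ : psi μ Φ = calibrationGap (expectedLoss μ Φ)) (s₀ : Label) {f : ℕ → 𝒳 → ℝ}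
    (hf : ∀ n, Measurable (f n))
    (h : Tendsto (fun n => ensembleRisk μ Φ P (f n)) atTop (𝓝 (ensembleRiskInf μ Φ P))) :
    Tendsto (fun n => risk s₀ P (f n)) atTop (𝓝 (riskInf s₀ P)) := by
  have hr := EReal.coe_toReal (ensembleRiskInf_ne_top (μ := μ) (Φ := Φ) (P := P))
    (ensembleRiskInf_ne_bot hF)
  refine tendsto_order.2 ⟨fun a ha => Eventually.of_forall fun n =>
    ha.trans_le (riskInf_le s₀ (hf n)), fun a ha => ?_⟩
  -- Any positive `θ` below both the target gap and `1` works: once the excess surrogate risk is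
  -- below `ψ θ > 0`, the excess risk is at most `θ`.
  obtain ⟨θ, hθ0, hθ⟩ := exists_between (lt_min (sub_pos.2 ha) one_pos)
  have hmem : θ ∈ Icc (0 : ℝ) 1 := ⟨hθ0.le, (hθ.trans_le (min_le_right _ _)).le⟩
  have hpos : 0 < psi μ Φ θ := hψ ▸ hF.calibrationGap_pos hmem hθ0
  have hlt : ensembleRiskInf μ Φ P < psi μ Φ θ + ensembleRiskInf μ Φ P := by
    rw [← hr, ← EReal.coe_add, EReal.coe_lt_coe_iff]
    linarith
  filter_upwards [h.eventually_lt_const hlt] with n hn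
  have h₁ := psiInv_le_of_lt (hψ ▸ hF.strictMonoOn_calibrationGap) hmem
    (EReal.sub_lt_of_lt_add hn)
  have h₂ := risk_sub_riskInf_le_psiInv hF hψ s₀ (hf n) (P := P)
  linarith [hθ.trans_le (min_le_left _ _)]

end EnsembleRisk

theorem theorem2 {𝒳 Ω : Type*} [MeasurableSpace 𝒳] [MeasurableSpace Ω]
    (μ : Measure Ω) [IsProbabilityMeasure μ]
    (𝓛 : Set (ℝ → ℝ)) (h𝓛 : ∀ φ ∈ 𝓛, IsBCCLoss φ)
    (Φ : Ω → 𝓛) (hΦ : Measurable Φ) (hA : RandomLossAssumption μ Φ) (s₀ : Label) :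
    -- classification-calibration of the ensemble risk
    (∀ (P : Measure (𝒳 × Label)) [IsProbabilityMeasure P] (f : ℕ → 𝒳 → ℝ),
      (∀ n, Measurable (f n)) →
      Tendsto (fun n => ensembleRisk μ Φ P (f n)) atTop (𝓝 (ensembleRiskInf μ Φ P)) →
      Tendsto (fun n => risk s₀ P (f n)) atTop (𝓝 (riskInf s₀ P))) ∧
    -- `ψ` is invertible from `[0, 1]` onto `[0, ψ(1)]`
    (psi μ Φ 0 = 0 ∧ StrictMonoOn (psi μ Φ) (Icc 0 1) ∧
      BijOn (psi μ Φ) (Icc 0 1) (Icc 0 (psi μ Φ 1))) ∧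
    -- the excess risk bound, the infimum of the ensemble risk being finite
    (∀ (P : Measure (𝒳 × Label)) [IsProbabilityMeasure P],
      ensembleRiskInf μ Φ P ≠ ⊥ ∧ ensembleRiskInf μ Φ P ≠ ⊤ ∧
      ∀ f : 𝒳 → ℝ, Measurable f →
        risk s₀ P f - riskInf s₀ P
          ≤ psiInv μ Φ (ensembleRisk μ Φ P f - ensembleRiskInf μ Φ P)) := by
  have hF := hA.isBCCLoss_expectedLoss h𝓛
  have hψ := psi_eq_calibrationGap hA.integrable_eval
  refine ⟨fun P _ f hf h => tendsto_risk hF hψ s₀ hf h, ?_, fun P _ =>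
    ⟨ensembleRiskInf_ne_bot hF, ensembleRiskInf_ne_top, fun f hf =>
      risk_sub_riskInf_le_psiInv hF hψ s₀ hf⟩⟩
  rw [hψ]
  exact ⟨hF.calibrationGap_zero, hF.strictMonoOn_calibrationGap, hF.bijOn_calibrationGap⟩
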